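/- **Theorem 1 (Constant-limit effective rank).** Let $D$ be a probability distribution on a measurable space $\mathcal X$, let $x,x',x_1,x_2,\dots$ be i.i.d. with law $D$, and let $k:\mathcal X\times\mathcal X\to\mathbb R$ be a measurable kernel. For a random variable $X$ write $\|X\|_{\psi_1}=\inf\{t>0:\mathbb E\,e^{|X|/t}\le 2\}$ ($\inf\emptyset=\infty$). Assume that $k(x,x)$ and $k(x,x')^2$ are sub-exponential, i.e. $\|k(x,x)\|_{\psi_1}<\infty$ and $\|k(x,x')^2\|_{\psi_1}<\infty$, and that $a:=\mathbb E[k(x,x)]>0$ and $b:=\mathbb E[k(x,x')^2]>0$. Let $\mathbf K_n=(k(x_i,x_j))_{i,j\le n}$, let $r_{\mathrm{eff}}(\mathbf K)=(\operatorname{tr}\mathbf K)^2/\|\mathbf K\|_F^2$ (with $r_{\mathrm{eff}}(0)=0$), and put $r_\infty:=a^2/b\in(0,\infty)$. Then: 1. $r_{\mathrm{eff}}(\mathbf K_n)$ is integrable for every $n$, and $\lim_{n\to\infty}\mathbb E[r_{\mathrm{eff}}(\mathbf K_n)]=r_\infty$. 2. If $k$ is a positive semidefinite kernel (every Gram matrix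 of $k$ is symmetric positive semidefinite), as is the case for every neural tangent kernel, then $1\le r_\infty<\infty$. Moreover $r_\infty=1$ if and only if $k(x,x')^2=k(x,x)\,k(x',x')$ almost surely; so $r_\infty\in(1,\infty)$ except in this degenerate (rank-one) case. 3. There are constants $c,C>0$, depending only on upper bounds for $\|k(x,x)\|_{\psi_1}$ and $\|k(x,x')^2\|_{\psi_1}$ and on $b$, such that for all $n\ge1$ and all $\varepsilon>0$ $$\mathbb P\bigl(|r_{\mathrm{eff}}(\mathbf K_n)-r_\infty|>\varepsilon\bigr)\le C\exp\bigl(-c\,n\min(\varepsilon,1)^2\bigr).$$ In particular the bound is $C\exp(-cn\varepsilon^2)$ for $0<\varepsilon\le1$, and for every $\varepsilon_0\ge1$ it is at most $C\exp(-c\,\varepsilon_0^{-2}\,n\varepsilon^2)$ for all $0<\varepsilon\le\varepsilon_0$. -/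

import Mathlib

open MeasureTheory ProbabilityTheory Filter Topology
open scoped ENNReal

noncomputable section

/-- The effective rank `(tr A)² / ‖A‖_F²` of a real square matrix, with `‖A‖_F² = ∑ i j, A i j ^ 2`
(the value is `0` for the zero matrix). -/
def effectiveRank {n : ℕ} (A : Matrix (Fin n) (Fin n) ℝ) : ℝ :=
  A.trace ^ 2 / ∑ i, ∑ j, A i j ^ 2

/-- The Gram matrix `(k (x i) (x j))` of the points `x 0, …, x (n - 1)`. -/
def gramMatrix {𝒳 : Type*} (k : 𝒳 → 𝒳 → ℝ) {n : ℕ} (x : Fin n → 𝒳) :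
    Matrix (Fin n) (Fin n) ℝ :=
  Matrix.of fun i j => k (x i) (x j)

/-- A positive semidefinite kernel: all its Gram matrices are symmetric positive semidefinite. -/
def IsPSDKernel {𝒳 : Type*} (k : 𝒳 → 𝒳 → ℝ) : Prop :=
  ∀ (n : ℕ) (x : Fin n → 𝒳), (gramMatrix k x).PosSemidef

/-- The `ψ₁` Orlicz norm `inf {t > 0 | E exp (|X| / t) ≤ 2}`, equal to `∞` if there is no such
`t`. -/
def psi1Norm {Ω : Type*} [MeasurableSpace Ω] (X : Ω → ℝ) (μ : Measure Ω) : ℝ≥0∞ :=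
  ⨅ (t : ℝ) (_ : 0 < t ∧ ∫⁻ ω, ENNReal.ofReal (Real.exp (|X ω| / t)) ∂μ ≤ 2), ENNReal.ofReal t

/-- The `ψ₁` norm of `k(x, x)` for `x ∼ D`. -/
def diagNorm {𝒳 : Type*} [MeasurableSpace 𝒳] (D : Measure 𝒳) (k : 𝒳 → 𝒳 → ℝ) : ℝ≥0∞ :=
  psi1Norm (fun x => k x x) D

/-- The `ψ₁` norm of `k(x, x')²` for independent `x, x' ∼ D`. -/
def sqNorm {𝒳 : Type*} [MeasurableSpace 𝒳] (D : Measure 𝒳) (k : 𝒳 → 𝒳 → ℝ) : ℝ≥0∞ :=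
  psi1Norm (fun p : 𝒳 × 𝒳 => k p.1 p.2 ^ 2) (D.prod D)

/-- `a = E k(x, x)` for `x ∼ D`. -/
def diagMean {𝒳 : Type*} [MeasurableSpace 𝒳] (D : Measure 𝒳) (k : 𝒳 → 𝒳 → ℝ) : ℝ :=
  ∫ x, k x x ∂D

/-- `b = E k(x, x')²` for independent `x, x' ∼ D`. -/
def sqMean {𝒳 : Type*} [MeasurableSpace 𝒳] (D : Measure 𝒳) (k : 𝒳 → 𝒳 → ℝ) : ℝ :=
  ∫ p : 𝒳 × 𝒳, k p.1 p.2 ^ 2 ∂(D.prod D)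

/-- The limit `r_∞ = a² / b`. -/
def limitRank {𝒳 : Type*} [MeasurableSpace 𝒳] (D : Measure 𝒳) (k : 𝒳 → 𝒳 → ℝ) : ℝ :=
  diagMean D k ^ 2 / sqMean D k

/-- The tail and moment conditions on a measurable kernel: `k(x, x)` and `k(x, x')²` are
sub-exponential (finite `ψ₁` norm; in particular integrable) and have positive means. -/
structure TailMoment {𝒳 : Type*} [MeasurableSpace 𝒳] (D : Measure 𝒳) (k : 𝒳 → 𝒳 → ℝ) :
    Prop where
  measurable : Measurable (Function.uncurry k)
  diagNorm_lt_top : diagNorm D k < ∞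
  sqNorm_lt_top : sqNorm D k < ∞
  diagMean_pos : 0 < diagMean D k
  sqMean_pos : 0 < sqMean D k

/-- `x 0, x 1, …` are independent random elements with common law `D`. -/
structure IsIIDSample {𝒳 Ω : Type*} [MeasurableSpace 𝒳] [MeasurableSpace Ω] (x : ℕ → Ω → 𝒳)
    (D : Measure 𝒳) (P : Measure Ω) : Prop where
  indep : iIndepFun x P
  law : ∀ i, HasLaw (x i) D P

/-- `r_eff (K_n)`, the effective rank of the Gram matrix of the first `n` sample points. -/
def sampleRank {𝒳 Ω : Type*} (k : 𝒳 → 𝒳 → ℝ) (x : ℕ → Ω → 𝒳) (n : ℕ) (ω : Ω) : ℝ :=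
  effectiveRank (gramMatrix k fun i : Fin n => x i ω)

end

/-!
The effective rank of the Gram matrix is `τ ^ 2 / f`, where `τ` is the trace divided by `n` and `f`
is the squared Frobenius norm divided by `n ^ 2`. The theorem follows once `τ` is close to
`a = E k(x, x)` and `f` is close to `b = E k(x, x')²` outside an event of exponentially small
probability, since `τ ^ 2 / f` is Lipschitz near `(a, b)` (`abs_sq_div_sub_sq_div_le`).

* `τ` is an empirical mean of independent sub-exponential variables, so Bernstein's inequality
  applies.
* The off-diagonal part of `f` is a U-statistic of order two. Following Hoeffding, it is the average
  over all permutations of the sample of means over `⌊n / 2⌋` disjoint, hence independent, pairs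
  (`Equiv.Perm.average_pairs_eq`). By convexity of `exp`, such an average satisfies the Bernstein
  bound of a single mean (`measureReal_le_abs_average_sub_le`).
* The diagonal part of `f` is `n ^ (-2) * ∑ k (x i) (x i) ^ 2`. The squares need not be
  sub-exponential, but the sum is at most `max |k (x i) (x i)| * ∑ |k (x i) (x i)|`. Here the sum
  is `O(n)` by Bernstein's inequality, and the maximum exceeds `δ * n` with probability at most
  `2 * n * exp (-c * δ * n)`. The factor `n` is harmless in the regime `n * ε ^ 2 ≥ 1`; in the
  remaining regime the claimed bound is trivial for a large constant (`sum_exp_terms_le`,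
  `exists_measureReal_abs_sampleRank_sub_gt_le`).

Convergence of the expectations follows, because the effective rank of an `n × n` matrix is at most
`n` by the Cauchy–Schwarz inequality, which the exponential tail outweighs.

For a positive semidefinite kernel, `k(x, x')² ≤ k(x, x) k(x', x')`, and `a ^ 2 - b` is the integral
of the nonnegative difference; it vanishes exactly if the difference vanishes almost everywhere.
-/

/-! ### Sub-exponential random variables -/

/-- `X` is sub-exponential at scale `t`: `E exp (|X| / t) ≤ 2`. This is the condition inside the
infimum that defines `psi1Norm`, together with almost everywhere measurability; a random variable
satisfies it at every scale above its `ψ₁` norm. -/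
structure IsSubExp {Ω : Type*} [MeasurableSpace Ω] (X : Ω → ℝ) (μ : Measure Ω) (t : ℝ) : Prop where
  aemeasurable : AEMeasurable X μ
  pos : 0 < t
  lintegral_exp_le : ∫⁻ ω, ENNReal.ofReal (Real.exp (|X ω| / t)) ∂μ ≤ 2

theorem isSubExp_of_psi1Norm_le {Ω : Type*} [MeasurableSpace Ω] {X : Ω → ℝ} {μ : Measure Ω}
    {K t : ℝ} (hX : AEMeasurable X μ) (hK : psi1Norm X μ ≤ ENNReal.ofReal K) (hKt : K < t)
    (ht : 0 < t) : IsSubExp X μ t := by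
  have h : psi1Norm X μ < ENNReal.ofReal t :=
    hK.trans_lt ((ENNReal.ofReal_lt_ofReal_iff ht).2 hKt)
  simp only [psi1Norm, iInf_lt_iff] at h
  obtain ⟨s, ⟨hs, hs'⟩, hst⟩ := h
  refine ⟨hX, ht, (lintegral_mono fun ω => ?_).trans hs'⟩
  have := ((ENNReal.ofReal_lt_ofReal_iff ht).1 hst).le
  gcongr

namespace IsSubExp

variable {Ω : Type*} [MeasurableSpace Ω] {X : Ω → ℝ} {μ : Measure Ω} {t : ℝ}

theorem comp_hasLaw {Ω' : Type*} [MeasurableSpace Ω'] {P : Measure Ω'} {Y : Ω' → Ω}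
    (h : IsSubExp X μ t) (hY : HasLaw Y μ P) : IsSubExp (fun ω => X (Y ω)) P t where
  aemeasurable := (hY.map_eq ▸ h.aemeasurable).comp_aemeasurable hY.aemeasurable
  pos := h.pos
  lintegral_exp_le := by
    have hm := h.aemeasurable
    rw [hY.lintegral_comp (f := fun y => ENNReal.ofReal (Real.exp (|X y| / t))) (by fun_prop)]
    exact h.lintegral_exp_le

theorem neg (h : IsSubExp X μ t) : IsSubExp (fun ω => -X ω) μ t :=
  ⟨h.aemeasurable.neg, h.pos, by simpa using h.lintegral_exp_le⟩

theorem abs (h : IsSubExp X μ t) : IsSubExp (fun ω => |X ω|) μ t :=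
  ⟨by have := h.aemeasurable; fun_prop, h.pos, by simpa using h.lintegral_exp_le⟩

theorem integrable_exp (h : IsSubExp X μ t) : Integrable (fun ω => Real.exp (|X ω| / t)) μ := by
  have hm := h.aemeasurable
  refine ⟨by fun_prop, ?_⟩
  rw [hasFiniteIntegral_iff_ofReal (ae_of_all _ fun _ => (Real.exp_pos _).le)]
  exact h.lintegral_exp_le.trans_lt (by simp)

theorem integral_exp_le (h : IsSubExp X μ t) : ∫ ω, Real.exp (|X ω| / t) ∂μ ≤ 2 := by
  rw [integral_eq_lintegral_of_nonneg_ae (ae_of_all _ fun _ => (Real.exp_pos _).le)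
    h.integrable_exp.aestronglyMeasurable]
  exact ENNReal.toReal_le_of_le_ofReal (by norm_num) (by simpa using h.lintegral_exp_le)

theorem integrable (h : IsSubExp X μ t) : Integrable X μ := by
  refine (h.integrable_exp.const_mul t).mono' h.aemeasurable.aestronglyMeasurable
    (ae_of_all _ fun ω => ?_)
  have h1 := Real.add_one_le_exp (|X ω| / t)
  have h2 : |X ω| = t * (|X ω| / t) := by field_simp [h.pos.ne']
  calc ‖X ω‖ = t * (|X ω| / t) := h2
    _ ≤ _ := mul_le_mul_of_nonneg_left (by linarith) h.pos.le

theorem integral_abs_le [IsProbabilityMeasure μ] (h : IsSubExp X μ t) : ∫ ω, |X ω| ∂μ ≤ t := by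
  have h1 : ∫ ω, |X ω| ∂μ ≤ ∫ ω, t * (Real.exp (|X ω| / t) - 1) ∂μ := by
    refine integral_mono h.integrable.abs
      ((h.integrable_exp.sub (integrable_const 1)).const_mul t) fun ω => ?_
    have h2 : |X ω| = t * (|X ω| / t) := by field_simp [h.pos.ne']
    have h3 := Real.add_one_le_exp (|X ω| / t)
    calc |X ω| = t * (|X ω| / t) := h2
      _ ≤ _ := mul_le_mul_of_nonneg_left (by linarith) h.pos.le
  rw [integral_const_mul, integral_sub h.integrable_exp (integrable_const 1)] at h1
  have := h.integral_exp_le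
  simp only [integral_const, probReal_univ, smul_eq_mul, mul_one] at h1
  nlinarith [h.pos]

theorem abs_integral_le [IsProbabilityMeasure μ] (h : IsSubExp X μ t) : |∫ ω, X ω ∂μ| ≤ t :=
  (abs_integral_le_integral_abs).trans h.integral_abs_le

theorem measureReal_le_abs_le [IsFiniteMeasure μ] (h : IsSubExp X μ t) (s : ℝ) :
    μ.real {ω | s ≤ |X ω|} ≤ 2 * Real.exp (-(s / t)) := by
  have hm := mul_meas_ge_le_integral_of_nonneg (μ := μ)
    (ae_of_all _ fun ω => (Real.exp_pos (|X ω| / t)).le) h.integrable_exp (Real.exp (s / t))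
  have hset : {ω | Real.exp (s / t) ≤ Real.exp (|X ω| / t)} = {ω | s ≤ |X ω|} := by
    ext ω
    simp [div_le_div_iff_of_pos_right h.pos]
  rw [hset] at hm
  rw [Real.exp_neg, ← div_eq_mul_inv, le_div_iff₀ (Real.exp_pos _), mul_comm]
  exact hm.trans h.integral_exp_le

end IsSubExp

theorem Real.exp_le_one_add_add_sq_mul_exp_abs (u : ℝ) :
    Real.exp u ≤ 1 + u + u ^ 2 * Real.exp |u| := by
  have hE : 1 ≤ Real.exp |u| := Real.one_le_exp (abs_nonneg u)
  rcases le_or_gt |u| 1 with h | h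
  · have := (abs_le.1 (Real.abs_exp_sub_one_sub_id_le h)).2
    nlinarith [sq_nonneg u]
  · rcases lt_abs.1 h with h' | h'
    · rw [abs_of_pos (by linarith)] at hE ⊢
      nlinarith [mul_le_mul_of_nonneg_right (show 1 ≤ u ^ 2 by nlinarith) (Real.exp_pos u).le]
    · have : Real.exp u ≤ 1 := Real.exp_le_one_iff.2 (by linarith)
      nlinarith [sq_nonneg u]

theorem Real.sq_le_mul_exp_half {v : ℝ} (hv : 0 ≤ v) : v ^ 2 ≤ 8 * Real.exp (v / 2) := by
  have := Real.quadratic_le_exp_of_nonneg (x := v / 2) (by positivity)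
  nlinarith

namespace IsSubExp

variable {Ω : Type*} [MeasurableSpace Ω] {X : Ω → ℝ} {μ : Measure Ω} {t : ℝ}

theorem integrable_exp_mul_sub [IsProbabilityMeasure μ] (h : IsSubExp X μ t) {θ : ℝ}
    (hθ : |θ| * t ≤ 1 / 2) (a : ℝ) : Integrable (fun ω => Real.exp (θ * (X ω - a))) μ := by
  have hm := h.aemeasurable
  refine (h.integrable_exp.const_mul (Real.exp (|θ| * |a|))).mono' (by fun_prop)
    (ae_of_all _ fun ω => ?_)
  rw [Real.norm_eq_abs, abs_of_pos (Real.exp_pos _), ← Real.exp_add]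
  have h1 : θ * (X ω - a) ≤ |θ| * (|X ω| + |a|) := by
    refine (le_abs_self _).trans ?_
    rw [abs_mul]
    gcongr
    exact abs_sub _ _
  have h2 : |θ| * |X ω| ≤ |X ω| / t := by
    rw [le_div_iff₀ h.pos]
    nlinarith [abs_nonneg (X ω)]
  gcongr
  linarith

/-- The moment generating function of a centred sub-exponential variable is sub-Gaussian near
`0`. -/
theorem integral_exp_mul_sub_le [IsProbabilityMeasure μ] (h : IsSubExp X μ t) {θ : ℝ}
    (hθ : |θ| * t ≤ 1 / 2) :
    ∫ ω, Real.exp (θ * (X ω - ∫ ω', X ω' ∂μ)) ∂μ ≤ Real.exp (44 * t ^ 2 * θ ^ 2) := by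
  set a := ∫ ω', X ω' ∂μ with ha
  have ht := h.pos
  have hat : |a| ≤ t := h.abs_integral_le
  have hpt (ω : Ω) : Real.exp (θ * (X ω - a)) ≤
      1 + θ * (X ω - a) + θ ^ 2 * (t ^ 2 * (8 * Real.exp 1)) * Real.exp (|X ω| / t) := by
    refine (Real.exp_le_one_add_add_sq_mul_exp_abs _).trans ?_
    gcongr 1 + _ + ?_
    set z := |X ω| / t with hz
    have hXz : |X ω| = t * z := by rw [hz]; field_simp
    have hz0 : 0 ≤ z := by positivity
    have hY : |X ω - a| ≤ t * (z + 1) := (abs_sub _ _).trans (by linarith)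
    have h1 : (X ω - a) ^ 2 ≤ t ^ 2 * (8 * Real.exp ((z + 1) / 2)) := by
      calc (X ω - a) ^ 2 = |X ω - a| ^ 2 := (sq_abs _).symm
        _ ≤ (t * (z + 1)) ^ 2 := by gcongr
        _ = t ^ 2 * (z + 1) ^ 2 := by ring
        _ ≤ _ := by gcongr; exact Real.sq_le_mul_exp_half (by positivity)
    have h2 : |θ * (X ω - a)| ≤ (z + 1) / 2 := by
      rw [abs_mul]
      calc |θ| * |X ω - a| ≤ |θ| * (t * (z + 1)) := by gcongr
        _ = (|θ| * t) * (z + 1) := by ring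
        _ ≤ 1 / 2 * (z + 1) := by gcongr
        _ = _ := by ring
    calc (θ * (X ω - a)) ^ 2 * Real.exp |θ * (X ω - a)|
        = θ ^ 2 * ((X ω - a) ^ 2 * Real.exp |θ * (X ω - a)|) := by ring
      _ ≤ θ ^ 2 * (t ^ 2 * (8 * Real.exp ((z + 1) / 2)) * Real.exp ((z + 1) / 2)) := by gcongr
      _ = θ ^ 2 * (t ^ 2 * (8 * (Real.exp ((z + 1) / 2) * Real.exp ((z + 1) / 2)))) := by ring
      _ = θ ^ 2 * (t ^ 2 * (8 * (Real.exp 1 * Real.exp z))) := by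
        rw [← Real.exp_add, ← Real.exp_add]; ring_nf
      _ = _ := by ring
  have hi1 : Integrable (fun ω => 1 + θ * (X ω - a)) μ :=
    (integrable_const 1).add ((h.integrable.sub (integrable_const a)).const_mul θ)
  have hi2 := h.integrable_exp.const_mul (θ ^ 2 * (t ^ 2 * (8 * Real.exp 1)))
  have h0 : ∫ ω, (1 + θ * (X ω - a)) ∂μ = 1 := by
    have hi : Integrable (fun ω => X ω - a) μ := h.integrable.sub (integrable_const a)
    rw [integral_add (integrable_const 1) (hi.const_mul θ), integral_const_mul,
      integral_sub h.integrable (integrable_const a)]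
    simp [← ha]
  calc ∫ ω, Real.exp (θ * (X ω - a)) ∂μ
      ≤ ∫ ω, (1 + θ * (X ω - a) + θ ^ 2 * (t ^ 2 * (8 * Real.exp 1)) * Real.exp (|X ω| / t)) ∂μ :=
        integral_mono (h.integrable_exp_mul_sub hθ a) (hi1.add hi2) hpt
    _ = 1 + θ ^ 2 * (t ^ 2 * (8 * Real.exp 1)) * ∫ ω, Real.exp (|X ω| / t) ∂μ := by
        rw [integral_add hi1 hi2, h0, integral_const_mul]
    _ ≤ 1 + θ ^ 2 * (t ^ 2 * (8 * 2.75)) * 2 := by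
        gcongr
        · linarith [Real.exp_one_lt_d9]
        · exact h.integral_exp_le
    _ = 44 * t ^ 2 * θ ^ 2 + 1 := by ring
    _ ≤ _ := Real.add_one_le_exp _

end IsSubExp

/-! ### Concentration of averages of sums of independent variables -/

/-- One-sided form of `measureReal_le_abs_average_sub_le`. -/
theorem measureReal_le_average_sub_le {Ω ι : Type*} [MeasurableSpace Ω] {P : Measure Ω}
    [IsProbabilityMeasure P] [Fintype ι] [Nonempty ι] {m : ℕ} (hm : 0 < m)
    {Y : ι → Fin m → Ω → ℝ} {a t δ : ℝ} (hmeas : ∀ σ l, Measurable (Y σ l))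
    (hind : ∀ σ, iIndepFun (Y σ) P) (hY : ∀ σ l, IsSubExp (Y σ l) P t)
    (hmean : ∀ σ l, ∫ ω, Y σ l ω ∂P = a) (hδ : 0 < δ) (hδt : δ ≤ t) :
    P.real {ω | δ ≤ (Fintype.card ι : ℝ)⁻¹ * ∑ σ, (m : ℝ)⁻¹ * ∑ l, Y σ l ω - a} ≤
      Real.exp (-(m * δ ^ 2 / (176 * t ^ 2))) := by
  have ht : 0 < t := hδ.trans_le hδt
  have hm' : (0 : ℝ) < m := by exact_mod_cast hm
  have hc : (0 : ℝ) < Fintype.card ι := by exact_mod_cast Fintype.card_pos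
  -- `θ` minimizes `-θ * δ + 44 * t ^ 2 * θ ^ 2`
  set θ : ℝ := δ / (88 * t ^ 2) with hθ
  have hθ0 : 0 ≤ θ := by positivity
  have hθt : |θ| * t ≤ 1 / 2 := by
    rw [abs_of_nonneg hθ0, hθ, div_mul_eq_mul_div, div_le_div_iff₀ (by positivity) (by norm_num)]
    nlinarith
  set S : ι → Ω → ℝ := fun σ => ∑ l, fun ω => Y σ l ω - a with hS
  have hindS (σ : ι) : iIndepFun (fun l ω => Y σ l ω - a) P :=
    (hind σ).comp (fun _ y => y - a) (fun _ => by fun_prop)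
  have hmeasS (σ : ι) (l : Fin m) : Measurable fun ω => Y σ l ω - a := (hmeas σ l).sub_const a
  have hint (σ : ι) : Integrable (fun ω => Real.exp (θ * S σ ω)) P :=
    (hindS σ).integrable_exp_mul_sum (hmeasS σ)
      fun l _ => (hY σ l).integrable_exp_mul_sub hθt a
  have hmgf (σ : ι) : ∫ ω, Real.exp (θ * S σ ω) ∂P ≤ Real.exp (m * (44 * t ^ 2 * θ ^ 2)) := by
    change mgf (S σ) P θ ≤ _
    rw [hS, (hindS σ).mgf_sum (hmeasS σ), Real.exp_nat_mul]
    refine (Finset.prod_le_prod (g := fun _ => Real.exp (44 * t ^ 2 * θ ^ 2))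
      (fun l _ => mgf_nonneg) fun l _ => ?_).trans_eq (by simp)
    have := (hY σ l).integral_exp_mul_sub_le hθt
    rwa [hmean] at this
  set Z : Ω → ℝ := fun ω => m * ((Fintype.card ι : ℝ)⁻¹ * ∑ σ, (m : ℝ)⁻¹ * ∑ l, Y σ l ω - a)
    with hZ
  have hZS (ω : Ω) : Z ω = ∑ σ, (Fintype.card ι : ℝ)⁻¹ * S σ ω := by
    simp only [hZ, hS, Finset.sum_apply, Finset.sum_sub_distrib, Finset.sum_const,
      Finset.card_univ, Fintype.card_fin, nsmul_eq_mul, ← Finset.mul_sum]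
    field_simp
  have hjensen (ω : Ω) :
      Real.exp (θ * Z ω) ≤ ∑ σ, (Fintype.card ι : ℝ)⁻¹ * Real.exp (θ * S σ ω) := by
    have := convexOn_exp.map_sum_le (t := Finset.univ) (w := fun _ : ι => (Fintype.card ι : ℝ)⁻¹)
      (p := fun σ => θ * S σ ω) (fun _ _ => by positivity) (by simp) (fun _ _ => Set.mem_univ _)
    simp only [smul_eq_mul] at this
    refine le_trans (le_of_eq ?_) this
    rw [hZS, Finset.mul_sum]
    congr 1
    exact Finset.sum_congr rfl fun σ _ => by ring
  have hintsum : Integrable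
      (fun ω => ∑ σ, (Fintype.card ι : ℝ)⁻¹ * Real.exp (θ * S σ ω)) P :=
    integrable_finsetSum _ fun σ _ => (hint σ).const_mul _
  have hZmeas : Measurable Z := by
    rw [hZ]
    fun_prop
  have hintZ : Integrable (fun ω => Real.exp (θ * Z ω)) P :=
    hintsum.mono' (by fun_prop) (ae_of_all _ fun ω => by
      rw [Real.norm_eq_abs, abs_of_pos (Real.exp_pos _)]; exact hjensen ω)
  have hmgfZ : mgf Z P θ ≤ Real.exp (m * (44 * t ^ 2 * θ ^ 2)) := by
    calc mgf Z P θ ≤ ∫ ω, ∑ σ, (Fintype.card ι : ℝ)⁻¹ * Real.exp (θ * S σ ω) ∂P :=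
          integral_mono hintZ hintsum hjensen
      _ = ∑ σ, (Fintype.card ι : ℝ)⁻¹ * ∫ ω, Real.exp (θ * S σ ω) ∂P := by
          rw [integral_finsetSum _ fun σ _ => (hint σ).const_mul _]
          simp_rw [integral_const_mul]
      _ ≤ ∑ _σ : ι, (Fintype.card ι : ℝ)⁻¹ * Real.exp (m * (44 * t ^ 2 * θ ^ 2)) := by
          gcongr with σ
          exact hmgf σ
      _ = _ := by
          simp only [Finset.sum_const, Finset.card_univ, nsmul_eq_mul]
          field_simp
  have hset : {ω | δ ≤ (Fintype.card ι : ℝ)⁻¹ * ∑ σ, (m : ℝ)⁻¹ * ∑ l, Y σ l ω - a} =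
      {ω | m * δ ≤ Z ω} := by
    ext ω
    simp [hZ, hm]
  rw [hset]
  calc P.real {ω | m * δ ≤ Z ω} ≤ Real.exp (-θ * (m * δ)) * mgf Z P θ :=
        measure_ge_le_exp_mul_mgf _ hθ0 hintZ
    _ ≤ Real.exp (-θ * (m * δ)) * Real.exp (m * (44 * t ^ 2 * θ ^ 2)) := by gcongr
    _ = _ := by
        rw [← Real.exp_add]
        congr 1
        rw [hθ]
        field_simp
        ring

/-- Bernstein's inequality in the form due to Hoeffding: it holds for the average over `σ` of
empirical means, where only the variables inside each mean are independent, with the rate of a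
single mean. By convexity of `exp` the moment generating function of the average is at most the
average of the moment generating functions. -/
theorem measureReal_le_abs_average_sub_le {Ω ι : Type*} [MeasurableSpace Ω] {P : Measure Ω}
    [IsProbabilityMeasure P] [Fintype ι] [Nonempty ι] {m : ℕ} (hm : 0 < m)
    {Y : ι → Fin m → Ω → ℝ} {a t δ : ℝ} (hmeas : ∀ σ l, Measurable (Y σ l))
    (hind : ∀ σ, iIndepFun (Y σ) P) (hY : ∀ σ l, IsSubExp (Y σ l) P t)
    (hmean : ∀ σ l, ∫ ω, Y σ l ω ∂P = a) (hδ : 0 < δ) (hδt : δ ≤ t) :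
    P.real {ω | δ ≤ |(Fintype.card ι : ℝ)⁻¹ * ∑ σ, (m : ℝ)⁻¹ * ∑ l, Y σ l ω - a|} ≤
      2 * Real.exp (-(m * δ ^ 2 / (176 * t ^ 2))) := by
  have h1 := measureReal_le_average_sub_le hm hmeas hind hY hmean hδ hδt
  have h2 := measureReal_le_average_sub_le (P := P) (Y := fun σ l ω => -Y σ l ω) (a := -a) hm
    (fun σ l => (hmeas σ l).neg) (fun σ => (hind σ).comp (fun _ y => -y) fun _ => measurable_neg)
    (fun σ l => (hY σ l).neg) (fun σ l => by rw [integral_neg, hmean]) hδ hδt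
  refine (measureReal_mono (fun ω hω => ?_)).trans
    ((measureReal_union_le _ _).trans ((add_le_add h1 h2).trans_eq (two_mul _).symm))
  refine (le_abs.1 (show δ ≤ |_| from hω)).imp id fun h => ?_
  simp only [Set.mem_ofPred_eq, Finset.sum_neg_distrib, mul_neg]
  linarith

/-- Disjoint pairs of independent variables are independent. -/
theorem ProbabilityTheory.iIndepFun.prodMk_pairs {Ω 𝒳 ι κ : Type*} [MeasurableSpace Ω]
    [MeasurableSpace 𝒳] {P : Measure Ω} {x : κ → Ω → 𝒳} (hx : ∀ i, Measurable (x i))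
    (h : iIndepFun x P) (e : ι × Bool → κ) (he : Function.Injective e) :
    iIndepFun (fun l ω => (x (e (l, false)) ω, x (e (l, true)) ω)) P := by
  have := h.isProbabilityMeasure
  have hprob (i : κ) : IsProbabilityMeasure (P.map (x i)) :=
    Measure.isProbabilityMeasure_map (hx i).aemeasurable
  have h1 : P.map (fun ω (p : ι × Bool) => x (e p) ω) =
      Measure.infinitePi fun p : ι × Bool => P.map (x (e (p.1, p.2))) :=
    (h.precomp he).map_fun_eq_infinitePi_map (fun p => hx _)
  have h2 (l : ι) : P.map (fun ω (b : Bool) => x (e (l, b)) ω) =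
      Measure.infinitePi fun b => P.map (x (e (l, b))) :=
    (h.precomp (he.comp (Prod.mk_right_injective l))).map_fun_eq_infinitePi_map (fun p => hx _)
  have h3 : iIndepFun (fun l ω (b : Bool) => x (e (l, b)) ω) P := by
    rw [iIndepFun_iff_map_fun_eq_infinitePi_map (by fun_prop)]
    simp_rw [h2]
    rw [← Measure.infinitePi_map_curry, ← h1,
      Measure.map_map (by fun_prop) (by fun_prop)]
    rfl
  exact h3.comp (fun _ f => (f false, f true)) fun _ => by fun_prop

/-! ### Off-diagonal sums as averages over permutations -/

theorem Equiv.Perm.sum_apply_apply_eq {V : Type*} [Fintype V] [DecidableEq V] (f : V → V → ℝ)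
    {p q p' q' : V} (h : p ≠ q) (h' : p' ≠ q') :
    ∑ σ : Equiv.Perm V, f (σ p) (σ q) = ∑ σ : Equiv.Perm V, f (σ p') (σ q') := by
  obtain ⟨τ, hτ⟩ := Equiv.Perm.exists_extending_pair (fun b : Bool => if b then p' else q')
    (fun b : Bool => if b then p else q)
    (by intro x y; cases x <;> cases y <;> simp [h', h'.symm])
    (by intro x y; cases x <;> cases y <;> simp [h, h.symm])
  have hp : τ p' = p := by simpa using hτ true
  have hq : τ q' = q := by simpa using hτ false
  refine Fintype.sum_equiv (Equiv.mulRight τ) _ _ fun σ => ?_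
  simp [hp, hq]

/-- Averaging over all permutations `σ` the mean of `f (σ p) (σ q)` over disjoint pairs `(p, q)`
gives the mean of `f` off the diagonal. -/
theorem Equiv.Perm.average_pairs_eq {V : Type*} [Fintype V] [DecidableEq V] (f : V → V → ℝ)
    {m : ℕ} (hm : 0 < m) (e : Fin m × Bool → V) (he : Function.Injective e) :
    (Fintype.card (Equiv.Perm V) : ℝ)⁻¹ *
        ∑ σ : Equiv.Perm V, (m : ℝ)⁻¹ * ∑ l, f (σ (e (l, false))) (σ (e (l, true))) =
      (∑ p ∈ (Finset.univ : Finset V).offDiag, f p.1 p.2) /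
        ((Finset.univ : Finset V).offDiag.card : ℝ) := by
  have hne (l : Fin m) : e (l, false) ≠ e (l, true) := fun h => by simpa using he h
  have hm' : (m : ℝ) ≠ 0 := by exact_mod_cast hm.ne'
  set W := ∑ σ : Equiv.Perm V, f (σ (e (⟨0, hm⟩, false))) (σ (e (⟨0, hm⟩, true))) with hW
  have h1 : ∑ σ : Equiv.Perm V, ∑ l, f (σ (e (l, false))) (σ (e (l, true))) = m * W := by
    rw [Finset.sum_comm, Finset.sum_congr rfl fun l _ =>
      Equiv.Perm.sum_apply_apply_eq f (hne l) (hne ⟨0, hm⟩)]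
    simp [hW]
  have h2 : ((Finset.univ : Finset V).offDiag.card : ℝ) * W =
      Fintype.card (Equiv.Perm V) * ∑ p ∈ (Finset.univ : Finset V).offDiag, f p.1 p.2 := by
    have h3 : ∑ p ∈ (Finset.univ : Finset V).offDiag, ∑ σ : Equiv.Perm V, f (σ p.1) (σ p.2) =
        ((Finset.univ : Finset V).offDiag.card : ℝ) * W := by
      rw [Finset.sum_congr rfl fun p hp =>
        Equiv.Perm.sum_apply_apply_eq f (Finset.mem_offDiag.1 hp).2.2 (hne ⟨0, hm⟩)]
      simp [hW]
    rw [← h3, Finset.sum_comm]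
    have h4 (σ : Equiv.Perm V) : ∑ p ∈ (Finset.univ : Finset V).offDiag, f (σ p.1) (σ p.2) =
        ∑ p ∈ (Finset.univ : Finset V).offDiag, f p.1 p.2 :=
      Finset.sum_equiv (σ.prodCongr σ) (by simp) (by simp)
    simp [h4]
  have hoff : ((Finset.univ : Finset V).offDiag.card : ℝ) ≠ 0 := by
    have : (e (⟨0, hm⟩, false), e (⟨0, hm⟩, true)) ∈ (Finset.univ : Finset V).offDiag := by
      simp [hne]
    exact_mod_cast (Finset.card_pos.2 ⟨_, this⟩).ne'
  have hc : (Fintype.card (Equiv.Perm V) : ℝ) ≠ 0 := by exact_mod_cast Fintype.card_ne_zero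
  rw [← Finset.mul_sum, h1, eq_div_iff hoff]
  field_simp
  linarith

theorem Finset.sum_sum_eq_diag_add_offDiag {V : Type*} [Fintype V] [DecidableEq V]
    (f : V → V → ℝ) : ∑ i, ∑ j, f i j =
      ∑ i, f i i + ∑ p ∈ (Finset.univ : Finset V).offDiag, f p.1 p.2 := by
  rw [← Finset.sum_product', ← Finset.diag_union_offDiag,
    Finset.sum_union (Finset.disjoint_diag_offDiag _), Finset.sum_diag]

/-! ### Stability of the effective rank -/

/-- The quotient `τ ^ 2 / f` is Lipschitz in `(τ, f)` near `(a, b)`. -/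
theorem abs_sq_div_sub_sq_div_le {a b t δ τ f : ℝ} (hδ1 : δ ≤ 1) (hδb : 8 * δ ≤ b)
    (hb : 0 < b) (hat : |a| ≤ t) (hτ : |τ - a| ≤ δ) (hf : |f - b| ≤ 4 * δ) :
    |τ ^ 2 / f - a ^ 2 / b| ≤ δ * (2 * (2 * t + 1) / b + 8 * t ^ 2 / b ^ 2) := by
  have hδ0 : 0 ≤ δ := (abs_nonneg _).trans hτ
  have ht0 : 0 ≤ t := (abs_nonneg _).trans hat
  have hfb : b / 2 ≤ f := by linarith [(abs_le.1 hf).1]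
  have hf0 : 0 < f := by linarith
  have h1 : |τ + a| ≤ 2 * t + 1 := by
    have : τ + a = (τ - a) + 2 * a := by ring
    rw [this]
    refine (abs_add_le _ _).trans ?_
    rw [abs_mul, abs_two]
    linarith
  have h2 : τ ^ 2 / f - a ^ 2 / b = ((τ - a) * (τ + a) * b - a ^ 2 * (f - b)) / (f * b) := by
    field_simp
    ring
  have h3 : |(τ - a) * (τ + a) * b - a ^ 2 * (f - b)| ≤
      δ * (2 * t + 1) * b + t ^ 2 * (4 * δ) := by
    refine (abs_sub _ _).trans ?_
    rw [abs_mul, abs_mul, abs_mul, abs_of_pos hb, abs_pow]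
    gcongr
  rw [h2, abs_div, abs_of_pos (mul_pos hf0 hb)]
  calc _ ≤ (δ * (2 * t + 1) * b + t ^ 2 * (4 * δ)) / (b / 2 * b) := by gcongr
    _ = _ := by
      field_simp
      ring

/-- Deterministic estimate for the Frobenius norm: the diagonal contributes at most `δ` if the
diagonal entries are small compared with `n` and have a bounded mean. -/
theorem abs_frobenius_sub_le {n : ℕ} (hn : 2 ≤ n) (A : Matrix (Fin n) (Fin n) ℝ) {b t δ : ℝ}
    (ht : 0 < t) (hδ0 : 0 < δ) (hb : 0 < b) (hbn : b ≤ n * δ)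
    (hU : |(∑ p ∈ (Finset.univ : Finset (Fin n)).offDiag, A p.1 p.2 ^ 2) /
      ((Finset.univ : Finset (Fin n)).offDiag.card : ℝ) - b| ≤ δ)
    (hmean : ∑ i, |A i i| ≤ n * (2 * t)) (hmax : ∀ i, |A i i| ≤ δ * n / (2 * t)) :
    |(∑ i, ∑ j, A i j ^ 2) / (n : ℝ) ^ 2 - b| ≤ 4 * δ := by
  have hn' : (2 : ℝ) ≤ n := by exact_mod_cast hn
  have hcard : ((Finset.univ : Finset (Fin n)).offDiag.card : ℝ) = n * n - n := by
    rw [Finset.offDiag_card, Nat.cast_sub (Nat.le_mul_self _)]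
    simp
  have hpos : (0 : ℝ) < n * n - n := by nlinarith
  rw [hcard] at hU
  set S := ∑ p ∈ (Finset.univ : Finset (Fin n)).offDiag, A p.1 p.2 ^ 2 with hS
  set U := S / (n * n - n : ℝ) with hUdef
  have hSU : S = U * (n * n - n : ℝ) := (div_mul_cancel₀ _ hpos.ne').symm
  have hdiag : ∑ i, A i i ^ 2 ≤ δ * n ^ 2 := by
    calc ∑ i, A i i ^ 2 ≤ ∑ i, δ * n / (2 * t) * |A i i| := by
          gcongr with i
          rw [← sq_abs, sq]
          gcongr
          exact hmax i
      _ = δ * n / (2 * t) * ∑ i, |A i i| := by rw [Finset.mul_sum]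
      _ ≤ δ * n / (2 * t) * (n * (2 * t)) := by gcongr
      _ = δ * n ^ 2 := by field_simp
  have hdiag0 : 0 ≤ ∑ i, A i i ^ 2 := by positivity
  rw [Finset.sum_sum_eq_diag_add_offDiag (fun i j => A i j ^ 2), ← hS, hSU]
  have hval : (∑ i, A i i ^ 2 + U * (n * n - n : ℝ)) / (n : ℝ) ^ 2 - b =
      (U - b) - U / n + (∑ i, A i i ^ 2) / (n : ℝ) ^ 2 := by
    field_simp
    ring
  rw [hval]
  have h1 : (∑ i, A i i ^ 2) / (n : ℝ) ^ 2 ≤ δ := by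
    rw [div_le_iff₀ (by positivity)]
    exact hdiag
  have h2 : |U / n| ≤ 2 * δ := by
    rw [abs_div, abs_of_pos (by linarith : (0 : ℝ) < n), div_le_iff₀ (by linarith)]
    have : |U| ≤ b + δ := by
      rw [abs_le] at hU ⊢
      constructor <;> linarith [hU.1, hU.2]
    nlinarith
  have h3 : |(∑ i, A i i ^ 2) / (n : ℝ) ^ 2| ≤ δ := by
    rwa [abs_of_nonneg (by positivity)]
  calc _ ≤ |U - b| + |U / n| + |(∑ i, A i i ^ 2) / (n : ℝ) ^ 2| :=
        (abs_add_le _ _).trans (add_le_add_left (abs_sub _ _) _)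
    _ ≤ _ := by linarith

/-! ### Concentration of the effective rank -/

/-- An explicit tail bound: the terms on the right control the normalized trace, the off-diagonal
part of the Frobenius norm, the mean of `|k (x i) (x i)|`, and its maximum. -/
theorem measureReal_abs_sampleRank_sub_gt_le {𝒳 Ω : Type*} [MeasurableSpace 𝒳] [MeasurableSpace Ω]
    {D : Measure 𝒳} [IsProbabilityMeasure D] {k : 𝒳 → 𝒳 → ℝ} {t δ : ℝ}
    (hk : Measurable (Function.uncurry k)) (hdiag : IsSubExp (fun x => k x x) D t)
    (hsq : IsSubExp (fun p : 𝒳 × 𝒳 => k p.1 p.2 ^ 2) (D.prod D) t) (ht : 1 ≤ t)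
    {P : Measure Ω} [IsProbabilityMeasure P] {x : ℕ → Ω → 𝒳} (hxm : ∀ i, Measurable (x i))
    (hx : IsIIDSample x D P) {n : ℕ} (hn : 2 ≤ n) (hδ0 : 0 < δ) (hδ1 : δ ≤ 1)
    (hδb : 8 * δ ≤ sqMean D k) (hbn : sqMean D k ≤ n * δ) :
    P.real {ω | δ * (2 * (2 * t + 1) / sqMean D k + 8 * t ^ 2 / sqMean D k ^ 2) <
        |sampleRank k x n ω - limitRank D k|} ≤
      2 * Real.exp (-(n * δ ^ 2 / (176 * t ^ 2))) +
      2 * Real.exp (-((n / 2 : ℕ) * δ ^ 2 / (176 * t ^ 2))) +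
      2 * Real.exp (-(n * 1 ^ 2 / (176 * t ^ 2))) +
      n * (2 * Real.exp (-(δ * n / (2 * t) / t))) := by
  have hn0 : 0 < n := by omega
  have hnR : (0 : ℝ) < n := by exact_mod_cast hn0
  have hb : 0 < sqMean D k := by linarith
  have hkd : Measurable fun y => k y y := hk.comp (measurable_id.prodMk measurable_id)
  have hks : Measurable fun p : 𝒳 × 𝒳 => k p.1 p.2 ^ 2 := hk.pow_const 2
  have hdi (i : ℕ) : IsSubExp (fun ω => k (x i ω) (x i ω)) P t := hdiag.comp_hasLaw (hx.law i)
  -- the trace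
  have hT := measureReal_le_abs_average_sub_le (P := P) (ι := Unit)
    (Y := fun _ (i : Fin n) ω => k (x i ω) (x i ω)) (a := diagMean D k) hn0
    (fun _ i => hkd.comp (hxm i))
    (fun _ => (hx.indep.precomp Fin.val_injective).comp (fun _ y => k y y) fun _ => hkd)
    (fun _ i => hdi i)
    (fun _ i => (hx.law i).integral_comp hkd.aestronglyMeasurable) hδ0 (hδ1.trans ht)
  -- the mean of the absolute values of the diagonal entries
  have hM := measureReal_le_abs_average_sub_le (P := P) (ι := Unit)
    (Y := fun _ (i : Fin n) ω => |k (x i ω) (x i ω)|) (a := ∫ y, |k y y| ∂D) hn0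
    (fun _ i => (hkd.comp (hxm i)).abs)
    (fun _ => (hx.indep.precomp Fin.val_injective).comp (fun _ y => |k y y|) fun _ => hkd.abs)
    (fun _ i => (hdi i).abs)
    (fun _ i => (hx.law i).integral_comp hkd.abs.aestronglyMeasurable) one_pos ht
  -- the off-diagonal part, with the pairs `(2 l, 2 l + 1)`
  let e : Fin (n / 2) × Bool → Fin n := fun p => ⟨2 * p.1 + p.2.toNat, by
    have := p.1.2
    have := p.2.toNat_le
    omega⟩
  have he : Function.Injective e := by
    rintro ⟨l, c⟩ ⟨l', c'⟩ h
    simp only [e, Fin.mk.injEq] at h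
    have := c.toNat_le
    have := c'.toNat_le
    have h1 : c.toNat = c'.toNat := by omega
    have h2 : (l : ℕ) = l' := by omega
    exact Prod.ext (Fin.ext h2) (by cases c <;> cases c' <;> simp_all)
  have hpair {i j : ℕ} (hij : i ≠ j) : HasLaw (fun ω => (x i ω, x j ω)) (D.prod D) P :=
    ⟨((hxm i).prodMk (hxm j)).aemeasurable, by
      rw [(hx.indep.indepFun hij).map_prod_eq_prod_map_map (hxm i).aemeasurable
        (hxm j).aemeasurable, (hx.law i).map_eq, (hx.law j).map_eq]⟩
  have hne (σ : Equiv.Perm (Fin n)) (l : Fin (n / 2)) :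
      (σ (e (l, false)) : ℕ) ≠ σ (e (l, true)) := fun h => by
    simpa using he (σ.injective (Fin.val_injective h))
  have hU := measureReal_le_abs_average_sub_le (P := P) (ι := Equiv.Perm (Fin n)) (m := n / 2)
    (Y := fun σ l ω => k (x (σ (e (l, false))) ω) (x (σ (e (l, true))) ω) ^ 2)
    (a := sqMean D k) (by omega) (fun σ l => hks.comp ((hxm _).prodMk (hxm _)))
    (fun σ => (hx.indep.prodMk_pairs hxm (fun p => ((σ (e p) : Fin n) : ℕ))
      (Fin.val_injective.comp (σ.injective.comp he))).comp (fun _ p => k p.1 p.2 ^ 2) fun _ => hks)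
    (fun σ l => hsq.comp_hasLaw (hpair (hne σ l)))
    (fun σ l => (hpair (hne σ l)).integral_comp hks.aestronglyMeasurable) hδ0 (hδ1.trans ht)
  -- the largest diagonal entry
  have hX : P.real (⋃ i : Fin n, {ω | δ * n / (2 * t) ≤ |k (x i ω) (x i ω)|}) ≤
      n * (2 * Real.exp (-(δ * n / (2 * t) / t))) := by
    refine (measureReal_iUnion_fintype_le _).trans ?_
    refine (Finset.sum_le_sum fun (i : Fin n) _ =>
      (hdi i).measureReal_le_abs_le (δ * n / (2 * t))).trans_eq ?_
    simp
  refine le_trans (measureReal_mono fun ω hω => ?_) ((measureReal_union_le _ _).trans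
    (add_le_add ((measureReal_union_le _ _).trans
      (add_le_add ((measureReal_union_le _ _).trans (add_le_add hT hU)) hM)) hX))
  by_contra hcon
  simp only [Set.mem_union, not_or, Set.mem_ofPred_eq, not_le, Set.mem_iUnion, not_exists] at hcon
  obtain ⟨⟨⟨hT', hU'⟩, hM'⟩, hX'⟩ := hcon
  rw [Set.mem_ofPred_eq] at hω
  refine absurd hω (not_lt.2 ?_)
  rw [Equiv.Perm.average_pairs_eq (fun i j : Fin n => k (x i ω) (x j ω) ^ 2) (by omega) e he] at hU'
  simp only [Fintype.card_unit, Nat.cast_one, inv_one, one_mul, Finset.univ_unique,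
    Finset.sum_singleton] at hT' hM'
  have hmean : ∑ i : Fin n, |k (x i ω) (x i ω)| ≤ n * (2 * t) := by
    have h1 := (abs_lt.1 hM').2
    have h2 := hdiag.integral_abs_le
    rw [← div_eq_inv_mul] at h1
    rw [← div_le_iff₀' hnR]
    linarith
  have hF := abs_frobenius_sub_le hn (gramMatrix k fun i : Fin n => x i ω) (by linarith) hδ0 hb hbn
    hU'.le hmean fun i => (hX' i).le
  have hmain := abs_sq_div_sub_sq_div_le hδ1 hδb hb hdiag.abs_integral_le hT'.le hF
  refine le_trans (le_of_eq ?_) hmain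
  congr 2
  simp only [sampleRank, effectiveRank, Matrix.trace, Matrix.diag, gramMatrix, Matrix.of_apply]
  rw [mul_pow, inv_pow, ← div_eq_inv_mul, div_div_div_cancel_right₀ (by positivity)]

theorem TailMoment.measurable_diag {𝒳 : Type*} [MeasurableSpace 𝒳] {D : Measure 𝒳}
    {k : 𝒳 → 𝒳 → ℝ} (h : TailMoment D k) : Measurable fun x => k x x :=
  h.measurable.comp (measurable_id.prodMk measurable_id)

theorem TailMoment.measurable_sq {𝒳 : Type*} [MeasurableSpace 𝒳] {D : Measure 𝒳}
    {k : 𝒳 → 𝒳 → ℝ} (h : TailMoment D k) : Measurable fun p : 𝒳 × 𝒳 => k p.1 p.2 ^ 2 :=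
  h.measurable.pow_const 2

/-- Almost everywhere measurable sample points can be replaced by measurable ones. -/
theorem IsIIDSample.exists_measurable {𝒳 Ω : Type*} [MeasurableSpace 𝒳] [MeasurableSpace Ω]
    {x : ℕ → Ω → 𝒳} {D : Measure 𝒳} {P : Measure Ω} (h : IsIIDSample x D P) :
    ∃ x' : ℕ → Ω → 𝒳, (∀ i, Measurable (x' i)) ∧ IsIIDSample x' D P ∧ ∀ i, x i =ᵐ[P] x' i := by
  have hm (i : ℕ) := (h.law i).aemeasurable
  have hae (i : ℕ) : x i =ᵐ[P] (hm i).mk := (hm i).ae_eq_mk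
  exact ⟨fun i => (hm i).mk, fun i => (hm i).measurable_mk,
    ⟨(iIndepFun_congr hae).1 h.indep, fun i => (h.law i).congr (hae i).symm⟩, hae⟩

/-- The four exponential terms of `measureReal_abs_sampleRank_sub_gt_le` at `δ = η * e` are
absorbed into a single one; the factor `n` of the last term costs half of its rate, since
`n ≤ (n * e) ^ 2`. -/
theorem sum_exp_terms_le {t η κ c e : ℝ} {n : ℕ} (ht : 1 ≤ t) (hη : 0 < η) (hη1 : η ≤ 1)
    (hκ : κ = η / (2 * t ^ 2)) (hc : c ≤ η ^ 2 / (528 * t ^ 2)) (hcκ : c ≤ κ / 2)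
    (he : 0 < e) (he1 : e ≤ 1) (hn : 2 ≤ n) (hne : 1 ≤ n * e ^ 2) :
    2 * Real.exp (-(n * (η * e) ^ 2 / (176 * t ^ 2))) +
      2 * Real.exp (-((n / 2 : ℕ) * (η * e) ^ 2 / (176 * t ^ 2))) +
      2 * Real.exp (-(n * 1 ^ 2 / (176 * t ^ 2))) +
      n * (2 * Real.exp (-(η * e * n / (2 * t) / t))) ≤
    (6 + 16 / κ ^ 2) * Real.exp (-c * n * e ^ 2) := by
  have hn0 : (0 : ℝ) < n := by exact_mod_cast (by omega : 0 < n)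
  have hκ0 : 0 < κ := by rw [hκ]; positivity
  have hfloor : (n : ℝ) / 3 ≤ (n / 2 : ℕ) := by
    have h : (n : ℝ) ≤ ((3 * (n / 2) : ℕ) : ℝ) := by exact_mod_cast (by omega)
    push_cast at h
    linarith
  have hce : c * n * e ^ 2 ≤ n * (η * e) ^ 2 / (528 * t ^ 2) := by
    calc c * n * e ^ 2 ≤ η ^ 2 / (528 * t ^ 2) * n * e ^ 2 := by gcongr
      _ = _ := by ring
  have h528 : n * (η * e) ^ 2 / (528 * t ^ 2) = n / 3 * (η * e) ^ 2 / (176 * t ^ 2) := by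
    field_simp
    norm_num
  have hA : Real.exp (-(n * (η * e) ^ 2 / (176 * t ^ 2))) ≤ Real.exp (-c * n * e ^ 2) := by
    refine Real.exp_le_exp.2 ?_
    have : n / 3 * (η * e) ^ 2 / (176 * t ^ 2) ≤ n * (η * e) ^ 2 / (176 * t ^ 2) := by
      gcongr
      linarith
    linarith
  have hB : Real.exp (-((n / 2 : ℕ) * (η * e) ^ 2 / (176 * t ^ 2))) ≤
      Real.exp (-c * n * e ^ 2) := by
    refine Real.exp_le_exp.2 ?_
    have : n / 3 * (η * e) ^ 2 / (176 * t ^ 2) ≤ (n / 2 : ℕ) * (η * e) ^ 2 / (176 * t ^ 2) := by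
      gcongr
    linarith
  have hC : Real.exp (-(n * 1 ^ 2 / (176 * t ^ 2))) ≤ Real.exp (-c * n * e ^ 2) := by
    refine Real.exp_le_exp.2 ?_
    have : n / 3 * (η * e) ^ 2 / (176 * t ^ 2) ≤ n * 1 ^ 2 / (176 * t ^ 2) := by
      gcongr
      · linarith
      · exact mul_le_one₀ hη1 he.le he1
    linarith
  have hn2 : (n : ℝ) ≤ 8 / κ ^ 2 * Real.exp (κ * n * e / 2) := by
    have h1 := Real.sq_le_mul_exp_half (v := κ * n * e) (by positivity)
    rw [div_mul_eq_mul_div, le_div_iff₀ (by positivity)]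
    refine le_trans ?_ h1
    calc (n : ℝ) * κ ^ 2 = κ ^ 2 * n * 1 := by ring
      _ ≤ κ ^ 2 * n * (n * e ^ 2) := by gcongr
      _ = _ := by ring
  have hD : n * (2 * Real.exp (-(η * e * n / (2 * t) / t))) ≤
      16 / κ ^ 2 * Real.exp (-c * n * e ^ 2) := by
    have h1 : η * e * n / (2 * t) / t = κ * n * e := by
      rw [hκ]
      field_simp
    rw [h1]
    calc (n : ℝ) * (2 * Real.exp (-(κ * n * e)))
        ≤ 8 / κ ^ 2 * Real.exp (κ * n * e / 2) * (2 * Real.exp (-(κ * n * e))) := by gcongr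
      _ = 16 / κ ^ 2 * (Real.exp (κ * n * e / 2) * Real.exp (-(κ * n * e))) := by ring
      _ = 16 / κ ^ 2 * Real.exp (-(κ / 2 * n * e)) := by
          rw [← Real.exp_add]
          ring_nf
      _ ≤ _ := by
          gcongr
          have h2 : c * n * e ^ 2 ≤ κ / 2 * n * e := by
            gcongr
            exact pow_le_of_le_one he.le he1 two_ne_zero
          linarith
  linarith

universe u v in
/-- The effective rank of the Gram matrix concentrates around its limit, with constants that depend
only on the bounds for the tails and on `b`. -/
theorem exists_measureReal_abs_sampleRank_sub_gt_le (K₁ K₂ b : ℝ) :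
    ∃ c C : ℝ, 0 < c ∧ 0 < C ∧
      ∀ {𝒳 : Type u} [MeasurableSpace 𝒳] (D : Measure 𝒳) [IsProbabilityMeasure D]
        (k : 𝒳 → 𝒳 → ℝ), TailMoment D k →
        diagNorm D k ≤ ENNReal.ofReal K₁ → sqNorm D k ≤ ENNReal.ofReal K₂ → sqMean D k = b →
        ∀ {Ω : Type v} [MeasurableSpace Ω] (P : Measure Ω) [IsProbabilityMeasure P]
          (x : ℕ → Ω → 𝒳), IsIIDSample x D P →
          ∀ (n : ℕ) (ε : ℝ), 1 ≤ n → 0 < ε →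
            P.real {ω | ε < |sampleRank k x n ω - limitRank D k|} ≤
              C * Real.exp (-c * n * min ε 1 ^ 2) := by
  rcases le_or_gt b 0 with hb | hb
  · -- there is no kernel with `b ≤ 0`
    refine ⟨1, 1, one_pos, one_pos, fun D _ k hk _ _ hbk => ?_⟩
    exact absurd hk.sqMean_pos (by rw [hbk]; exact not_lt.2 hb)
  set t : ℝ := max (max K₁ K₂) 0 + 1 with ht
  have ht1 : 1 ≤ t := by linarith [le_max_right (max K₁ K₂) 0]
  have hK₁ : K₁ < t := by linarith [le_max_left (max K₁ K₂) 0, le_max_left K₁ K₂]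
  have hK₂ : K₂ < t := by linarith [le_max_left (max K₁ K₂) 0, le_max_right K₁ K₂]
  set L : ℝ := 2 * (2 * t + 1) / b + 8 * t ^ 2 / b ^ 2 with hL
  have hL0 : 0 < L := by positivity
  set η : ℝ := min (min 1 (b / 8)) (1 / L) with hηdef
  have hη0 : 0 < η := by positivity
  have hη1 : η ≤ 1 := (min_le_left _ _).trans (min_le_left _ _)
  have hηb : η ≤ b / 8 := (min_le_left _ _).trans (min_le_right _ _)
  have hηL : η * L ≤ 1 := (le_div_iff₀ hL0).1 (min_le_right _ _)
  set κ : ℝ := η / (2 * t ^ 2) with hκ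
  have hκ0 : 0 < κ := by positivity
  set c : ℝ := min (η ^ 2 / (528 * t ^ 2)) (κ / 2) with hc
  have hc0 : 0 < c := by positivity
  -- for `n * min ε 1 ^ 2 < M` the bound exceeds `1`
  set M : ℝ := max 2 (b / η) with hM
  refine ⟨c, Real.exp (c * M) + (6 + 16 / κ ^ 2), hc0, by positivity, ?_⟩
  intro 𝒳 _ D _ k hk hd hs hbk Ω _ P _ x hx n ε hn hε
  obtain ⟨x', hx'm, hx', hxx'⟩ := hx.exists_measurable
  have hae : ∀ᵐ ω ∂P, sampleRank k x n ω = sampleRank k x' n ω := by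
    filter_upwards [ae_all_iff.2 hxx'] with ω hω
    simp only [sampleRank, hω]
  have hset : {ω | ε < |sampleRank k x n ω - limitRank D k|} =ᵐ[P]
      {ω | ε < |sampleRank k x' n ω - limitRank D k|} := by
    filter_upwards [hae] with ω hω
    exact congrArg (fun r => ε < |r - limitRank D k|) hω
  rw [measureReal_congr hset]
  set e : ℝ := min ε 1 with he
  have he0 : 0 < e := by positivity
  have he1 : e ≤ 1 := min_le_right _ _
  have hn0 : (0 : ℝ) < n := by exact_mod_cast hn
  rw [add_mul]
  rcases lt_or_ge (n * e ^ 2) M with hlt | hge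
  · have h1 : 1 ≤ Real.exp (c * M) * Real.exp (-c * n * e ^ 2) := by
      rw [← Real.exp_add]
      refine Real.one_le_exp ?_
      nlinarith
    have h2 : 0 ≤ (6 + 16 / κ ^ 2) * Real.exp (-c * n * e ^ 2) := by positivity
    exact measureReal_le_one.trans (by linarith)
  have he2 : e ^ 2 ≤ e := pow_le_of_le_one he0.le he1 two_ne_zero
  have hne2 : 2 ≤ n * e ^ 2 := (le_max_left _ _).trans hge
  have hn2 : 2 ≤ n := by
    have : (2 : ℝ) ≤ n := by nlinarith
    exact_mod_cast this
  have hbn : b ≤ n * (η * e) := by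
    have h1 : b / η ≤ n * e := ((le_max_right _ _).trans hge).trans (by gcongr)
    rw [div_le_iff₀ hη0] at h1
    linarith
  have hmain := measureReal_abs_sampleRank_sub_gt_le (δ := η * e) hk.measurable
    (isSubExp_of_psi1Norm_le hk.measurable_diag.aemeasurable hd hK₁ (by linarith))
    (isSubExp_of_psi1Norm_le hk.measurable_sq.aemeasurable hs hK₂ (by linarith))
    ht1 hx'm hx' hn2 (by positivity) (mul_le_one₀ hη1 he0.le he1) (by rw [hbk]; nlinarith)
    (by rw [hbk]; exact hbn)
  rw [hbk, ← hL] at hmain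
  have hsum := sum_exp_terms_le ht1 hη0 hη1 hκ (min_le_left _ _) (min_le_right _ _) he0 he1 hn2
    (by linarith : 1 ≤ n * e ^ 2)
  have hle : P.real {ω | ε < |sampleRank k x' n ω - limitRank D k|} ≤
      P.real {ω | η * e * L < |sampleRank k x' n ω - limitRank D k|} := by
    refine measureReal_mono fun ω hω => lt_of_le_of_lt ?_ (show ε < _ from hω)
    calc η * e * L = η * L * e := by ring
      _ ≤ 1 * e := by gcongr
      _ ≤ ε := by rw [one_mul]; exact min_le_left _ _
  have h0 : 0 ≤ Real.exp (c * M) * Real.exp (-c * n * e ^ 2) := by positivity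
  linarith

/-! ### Convergence of the expected effective rank -/

theorem effectiveRank_nonneg {n : ℕ} (A : Matrix (Fin n) (Fin n) ℝ) : 0 ≤ effectiveRank A := by
  unfold effectiveRank
  positivity

theorem effectiveRank_le {n : ℕ} (A : Matrix (Fin n) (Fin n) ℝ) : effectiveRank A ≤ n := by
  refine div_le_of_le_mul₀ (by positivity) (by positivity) ?_
  calc A.trace ^ 2 ≤ n * ∑ i, A i i ^ 2 := by
        simpa [Matrix.trace] using sq_sum_le_card_mul_sum_sq (s := Finset.univ) (f := A.diag)
    _ ≤ _ := by
        gcongr with i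
        exact Finset.single_le_sum (f := fun j => A i j ^ 2) (fun j _ => sq_nonneg _)
          (Finset.mem_univ i)

theorem integrable_sampleRank {𝒳 Ω : Type*} [MeasurableSpace 𝒳] [MeasurableSpace Ω]
    {k : 𝒳 → 𝒳 → ℝ} (hk : Measurable (Function.uncurry k)) {P : Measure Ω} [IsFiniteMeasure P]
    {x : ℕ → Ω → 𝒳} (hx : ∀ i, AEMeasurable (x i) P) (n : ℕ) :
    Integrable (sampleRank k x n) P := by
  have hentry (i j : ℕ) : AEMeasurable (fun ω => k (x i ω) (x j ω)) P :=
    hk.comp_aemeasurable ((hx i).prodMk (hx j))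
  have hm : AEMeasurable (sampleRank k x n) P := by
    unfold sampleRank effectiveRank
    simp only [Matrix.trace, Matrix.diag, gramMatrix, Matrix.of_apply]
    fun_prop
  refine (integrable_const (n : ℝ)).mono' hm.aestronglyMeasurable (ae_of_all _ fun ω => ?_)
  rw [Real.norm_eq_abs, sampleRank, abs_of_nonneg (effectiveRank_nonneg _)]
  exact effectiveRank_le _

/-- Exponential concentration of `R n` around `r` forces `E R n → r` if `R n` takes values in
`[0, n]`. -/
theorem tendsto_integral_of_concentration {Ω : Type*} [MeasurableSpace Ω] {P : Measure Ω}
    [IsProbabilityMeasure P] {R : ℕ → Ω → ℝ} {r c C : ℝ} (hR : ∀ n, Integrable (R n) P)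
    (h0 : ∀ n ω, 0 ≤ R n ω) (hn : ∀ n ω, R n ω ≤ n) (hc : 0 < c)
    (h : ∀ (n : ℕ) (ε : ℝ), 1 ≤ n → 0 < ε →
      P.real {ω | ε < |R n ω - r|} ≤ C * Real.exp (-c * n * min ε 1 ^ 2)) :
    Tendsto (fun n => ∫ ω, R n ω ∂P) atTop (𝓝 r) := by
  have key (e : ℝ) (he : 0 < e) (n : ℕ) (hn1 : 1 ≤ n) :
      |∫ ω, R n ω ∂P - r| ≤ e + (n + |r|) * (C * Real.exp (-c * n * min e 1 ^ 2)) := by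
    set S : Set Ω := {ω | e < |R n ω - r|} with hS
    have hi : Integrable (fun ω => |R n ω - r|) P := ((hR n).sub (integrable_const r)).abs
    have hSm : NullMeasurableSet S P := nullMeasurableSet_lt aemeasurable_const hi.aemeasurable
    have hind : Integrable (S.indicator fun _ => (n + |r| : ℝ)) P :=
      (integrable_const _).indicator₀ hSm
    calc |∫ ω, R n ω ∂P - r| = |∫ ω, (R n ω - r) ∂P| := by
          rw [integral_sub (hR n) (integrable_const r)]
          simp
      _ ≤ ∫ ω, |R n ω - r| ∂P := abs_integral_le_integral_abs
      _ ≤ ∫ ω, (e + S.indicator (fun _ => (n + |r| : ℝ)) ω) ∂P := by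
          refine integral_mono hi ((integrable_const e).add hind) fun ω => ?_
          by_cases hω : ω ∈ S
          · rw [Set.indicator_of_mem hω]
            have h1 : |R n ω - r| ≤ |R n ω| + |r| := abs_sub _ _
            rw [abs_of_nonneg (h0 n ω)] at h1
            linarith [hn n ω]
          · rw [Set.indicator_of_notMem hω, add_zero]
            exact not_lt.1 hω
      _ = e + (n + |r|) * P.real S := by
          rw [integral_add (integrable_const e) hind, integral_indicator₀ hSm]
          simp [mul_comm]
      _ ≤ _ := by
          gcongr
          exact h n e hn1 he
  rw [Metric.tendsto_atTop']
  intro ε hε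
  set e := ε / 2 with he
  have he0 : 0 < e := by positivity
  set s : ℝ := c * min e 1 ^ 2 with hs
  have hs0 : 0 < s := by positivity
  have hlin : Tendsto (fun n : ℕ => s * (n : ℝ)) atTop atTop :=
    tendsto_natCast_atTop_atTop.const_mul_atTop hs0
  have h1 := (Real.tendsto_pow_mul_exp_neg_atTop_nhds_zero 1).comp hlin
  have h2 := (Real.tendsto_pow_mul_exp_neg_atTop_nhds_zero 0).comp hlin
  have h3 : Tendsto (fun n : ℕ => (n + |r|) * (C * Real.exp (-c * n * min e 1 ^ 2))) atTop
      (𝓝 0) := by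
    have := (h1.const_mul (C / s)).add (h2.const_mul (|r| * C))
    simp only [mul_zero, add_zero] at this
    refine this.congr fun n => ?_
    have hexp : -(s * (n : ℝ)) = -c * n * min e 1 ^ 2 := by rw [hs]; ring
    simp only [Function.comp_apply, hexp]
    field_simp
  obtain ⟨N, hN⟩ := eventually_atTop.1 (h3.eventually_lt_const he0)
  refine ⟨N + 1, fun n hnN => ?_⟩
  rw [Real.dist_eq]
  have := key e he0 n (by omega)
  have := hN n (by omega)
  linarith

/-! ### The limit for positive semidefinite kernels -/

theorem IsPSDKernel.sq_le_mul {𝒳 : Type*} {k : 𝒳 → 𝒳 → ℝ} (hk : IsPSDKernel k) (x y : 𝒳) :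
    k x y ^ 2 ≤ k x x * k y y := by
  have h := hk 2 ![x, y]
  have hdet := h.det_nonneg
  have hsymm := h.isHermitian.apply 0 1
  simp only [Matrix.det_fin_two, gramMatrix, Matrix.of_apply, Matrix.cons_val_zero,
    Matrix.cons_val_one, star_trivial] at hdet hsymm
  rw [hsymm] at hdet
  linarith [sq (k x y)]

theorem IsPSDKernel.one_le_limitRank_and_eq_one_iff {𝒳 : Type*} [MeasurableSpace 𝒳]
    {D : Measure 𝒳} [IsProbabilityMeasure D] {k : 𝒳 → 𝒳 → ℝ} (hk : IsPSDKernel k)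
    (hd : Integrable (fun x => k x x) D)
    (hs : Integrable (fun p : 𝒳 × 𝒳 => k p.1 p.2 ^ 2) (D.prod D)) (hb : 0 < sqMean D k) :
    1 ≤ limitRank D k ∧ (limitRank D k = 1 ↔
      ∀ᵐ p : 𝒳 × 𝒳 ∂(D.prod D), k p.1 p.2 ^ 2 = k p.1 p.1 * k p.2 p.2) := by
  have hprod : Integrable (fun p : 𝒳 × 𝒳 => k p.1 p.1 * k p.2 p.2) (D.prod D) := hd.mul_prod hd
  have hnonneg : 0 ≤ fun p : 𝒳 × 𝒳 => k p.1 p.1 * k p.2 p.2 - k p.1 p.2 ^ 2 :=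
    fun p => sub_nonneg.2 (hk.sq_le_mul p.1 p.2)
  have hdiff : ∫ p : 𝒳 × 𝒳, (k p.1 p.1 * k p.2 p.2 - k p.1 p.2 ^ 2) ∂(D.prod D) =
      diagMean D k ^ 2 - sqMean D k := by
    rw [integral_sub hprod hs, integral_prod_mul (fun x => k x x) (fun x => k x x), sq]
    rfl
  have hle : 0 ≤ diagMean D k ^ 2 - sqMean D k := hdiff ▸ integral_nonneg hnonneg
  refine ⟨(one_le_div hb).2 (by linarith), ?_⟩
  rw [limitRank, div_eq_one_iff_eq hb.ne', ← sub_eq_zero, ← hdiff,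
    integral_eq_zero_iff_of_nonneg hnonneg (hprod.sub hs)]
  refine eventually_congr (ae_of_all _ fun p => ?_)
  simp [sub_eq_zero, eq_comm]

theorem TailMoment.integrable_diag {𝒳 : Type*} [MeasurableSpace 𝒳] {D : Measure 𝒳}
    {k : 𝒳 → 𝒳 → ℝ} (h : TailMoment D k) : Integrable (fun x => k x x) D :=
  (isSubExp_of_psi1Norm_le h.measurable_diag.aemeasurable
    (ENNReal.ofReal_toReal h.diagNorm_lt_top.ne).ge (lt_add_one _) (by positivity)).integrable

theorem TailMoment.integrable_sq {𝒳 : Type*} [MeasurableSpace 𝒳] {D : Measure 𝒳}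
    {k : 𝒳 → 𝒳 → ℝ} (h : TailMoment D k) :
    Integrable (fun p : 𝒳 × 𝒳 => k p.1 p.2 ^ 2) (D.prod D) :=
  (isSubExp_of_psi1Norm_le h.measurable_sq.aemeasurable
    (ENNReal.ofReal_toReal h.sqNorm_lt_top.ne).ge (lt_add_one _) (by positivity)).integrable

theorem theorem1 :
    -- the limit of the expected effective rank, and the range of the limit
    (∀ {𝒳 : Type*} [MeasurableSpace 𝒳] (D : Measure 𝒳) [IsProbabilityMeasure D]
        (k : 𝒳 → 𝒳 → ℝ), TailMoment D k →
      (∀ {Ω : Type*} [MeasurableSpace Ω] (P : Measure Ω) [IsProbabilityMeasure P]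
          (x : ℕ → Ω → 𝒳), IsIIDSample x D P →
        (∀ n, Integrable (sampleRank k x n) P) ∧
        Tendsto (fun n => ∫ ω, sampleRank k x n ω ∂P) atTop (𝓝 (limitRank D k))) ∧
      (IsPSDKernel k →
        1 ≤ limitRank D k ∧
        (limitRank D k = 1 ↔
          ∀ᵐ p : 𝒳 × 𝒳 ∂(D.prod D), k p.1 p.2 ^ 2 = k p.1 p.1 * k p.2 p.2))) ∧
    -- concentration, with constants depending only on the two `ψ₁` norms and on `b`
    (∀ K₁ K₂ b : ℝ, ∃ c C : ℝ, 0 < c ∧ 0 < C ∧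
      ∀ {𝒳 : Type*} [MeasurableSpace 𝒳] (D : Measure 𝒳) [IsProbabilityMeasure D]
        (k : 𝒳 → 𝒳 → ℝ), TailMoment D k →
        diagNorm D k ≤ ENNReal.ofReal K₁ → sqNorm D k ≤ ENNReal.ofReal K₂ → sqMean D k = b →
        ∀ {Ω : Type*} [MeasurableSpace Ω] (P : Measure Ω) [IsProbabilityMeasure P]
          (x : ℕ → Ω → 𝒳), IsIIDSample x D P →
          ∀ (n : ℕ) (ε : ℝ), 1 ≤ n → 0 < ε →
            P.real {ω | ε < |sampleRank k x n ω - limitRank D k|} ≤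
              C * Real.exp (-c * n * min ε 1 ^ 2)) := by
  refine ⟨fun D _ k hk => ⟨fun P _ x hx => ?_, fun hpsd => ?_⟩,
    exists_measureReal_abs_sampleRank_sub_gt_le⟩
  · have hint := integrable_sampleRank hk.measurable fun i => (hx.law i).aemeasurable
    obtain ⟨c, C, hc, -, h⟩ := exists_measureReal_abs_sampleRank_sub_gt_le
      (diagNorm D k).toReal (sqNorm D k).toReal (sqMean D k)
    exact ⟨hint, tendsto_integral_of_concentration hint (fun _ _ => effectiveRank_nonneg _)
      (fun _ _ => effectiveRank_le _) hc (h D k hk (ENNReal.ofReal_toReal hk.diagNorm_lt_top.ne).ge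
        (ENNReal.ofReal_toReal hk.sqNorm_lt_top.ne).ge rfl P x hx)⟩
  · exact hpsd.one_le_limitRank_and_eq_one_iff hk.integrable_diag hk.integrable_sq hk.sqMean_pos
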